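/- Let $\Sigma_4=\{0,1,2,3\}$. A factor of a word is a finite contiguous subword. A finite or infinite word over $\Sigma_4$ is a \emph{Dean word} if it has none of $02,20,13,31$ as a factor and is square-free, i.e.\ has no factor $uu$ with $u$ nonempty. A finite word of length $\ell$ having a period $p\ge 1$ is a repetition of exponent $\ell/p$, and for rational $r$ a word is \emph{$r^+$-free} if none of its factors is a repetition of exponent greater than $r$. Then: (1) There exists an infinite $\frac53^+$-free Dean word that avoids $323$ (does not have $323$ as a factor). (2) Let $h$ be the $136$-uniform morphism on words over $\Sigma_4$ given by (line breaks are only typographical) $$\begin{array}{rl} h(0)={}&\texttt{0123032123012103012321012303210301210321230103}\\ &\texttt{2101232103012303212301032101230321030123210123}\\ &\texttt{01032123032101232103012103212301032101232103}\\ h(1)={}&\texttt{0123032123012103012321012303210301210321230103}\\ &\texttt{2101230321030123210123010321230321012321030123}\\ &\texttt{03212301032101230321030121032123032101232103}\\ h(2)={}&\texttt{0123032123012103012321012301032123012103012303}\\ &\texttt{2123010321012321030121032123010321012303210301}\\ &\texttt{23210123010321230321012321030121032123010321}\\ h(3)={}&\texttt{0123032123012103012321012301032123012103012303}\\ &\texttt{2123010321012303210301232101230103212303210123}\\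 &\texttt{21030123032123010321012321030121032123010321} \end{array}$$ For every $\frac75^+$-free word $w$ over $\Sigma_4$, finite or infinite, the image $h(w)$ is a $\frac53^+$-free Dean word that avoids $323$. -/

import Mathlib

/-- The factors (contiguous subwords) of a finite word. -/
def finFactors {α : Type*} (w : List α) : Set (List α) :=
  {u | u <:+: w}

/-- The (finite) factors of an infinite word. -/
def infFactors {α : Type*} (w : ℕ → α) : Set (List α) :=
  {u | ∃ i n : ℕ, u = (List.range n).map fun j => w (i + j)}

/-! The properties of words used below depend only on the set of factors of the word, so they are
stated for a set `F` of factors, and are applied to `finFactors w` and `infFactors w`. -/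

/-- The word with set of factors `F` avoids the word `v`. -/
def Avoids {α : Type*} (F : Set (List α)) (v : List α) : Prop :=
  v ∉ F

/-- No nonempty word of the form `uu` is a factor. -/
def SquareFreeWord {α : Type*} (F : Set (List α)) : Prop :=
  ∀ u : List α, u ≠ [] → Avoids F (u ++ u)

/-- `r⁺`-freeness: no factor is a repetition of exponent greater than `r`, where a word of length
`ℓ` with a period `p ≥ 1` is a repetition of exponent `ℓ / p`. -/
def PlusFree {α : Type*} (r : ℚ) (F : Set (List α)) : Prop :=
  ∀ u ∈ F, ∀ p : ℕ, 0 < p → u.HasPeriod p → (u.length : ℚ) / (p : ℚ) ≤ r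

/-- Reduced words over `{0, 1, 2, 3}`, where `0, 2` are mutually inverse and so are `1, 3`. -/
def ReducedWord (F : Set (List (Fin 4))) : Prop :=
  Avoids F [0, 2] ∧ Avoids F [2, 0] ∧ Avoids F [1, 3] ∧ Avoids F [3, 1]

/-- Dean words: square-free reduced words. -/
def DeanWord (F : Set (List (Fin 4))) : Prop :=
  ReducedWord F ∧ SquareFreeWord F

/-- The image of each letter under the 136-uniform morphism. -/
def deanBlock : Fin 4 → List (Fin 4)
  | 0 =>
     [0, 1, 2, 3, 0, 3, 2, 1, 2, 3, 0, 1, 2, 1, 0, 3, 0, 1, 2, 3, 2, 1, 0, 1, 2, 3, 0, 3, 2, 1, 0, 3, 0, 1,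
      2, 1, 0, 3, 2, 1, 2, 3, 0, 1, 0, 3, 2, 1, 0, 1, 2, 3, 2, 1, 0, 3, 0, 1, 2, 3, 0, 3, 2, 1, 2, 3, 0, 1,
      0, 3, 2, 1, 0, 1, 2, 3, 0, 3, 2, 1, 0, 3, 0, 1, 2, 3, 2, 1, 0, 1, 2, 3, 0, 1, 0, 3, 2, 1, 2, 3, 0, 3,
      2, 1, 0, 1, 2, 3, 2, 1, 0, 3, 0, 1, 2, 1, 0, 3, 2, 1, 2, 3, 0, 1, 0, 3, 2, 1, 0, 1, 2, 3, 2, 1, 0, 3]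
  | 1 =>
     [0, 1, 2, 3, 0, 3, 2, 1, 2, 3, 0, 1, 2, 1, 0, 3, 0, 1, 2, 3, 2, 1, 0, 1, 2, 3, 0, 3, 2, 1, 0, 3, 0, 1,
      2, 1, 0, 3, 2, 1, 2, 3, 0, 1, 0, 3, 2, 1, 0, 1, 2, 3, 0, 3, 2, 1, 0, 3, 0, 1, 2, 3, 2, 1, 0, 1, 2, 3,
      0, 1, 0, 3, 2, 1, 2, 3, 0, 3, 2, 1, 0, 1, 2, 3, 2, 1, 0, 3, 0, 1, 2, 3, 0, 3, 2, 1, 2, 3, 0, 1, 0, 3,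
      2, 1, 0, 1, 2, 3, 0, 3, 2, 1, 0, 3, 0, 1, 2, 1, 0, 3, 2, 1, 2, 3, 0, 3, 2, 1, 0, 1, 2, 3, 2, 1, 0, 3]
  | 2 =>
     [0, 1, 2, 3, 0, 3, 2, 1, 2, 3, 0, 1, 2, 1, 0, 3, 0, 1, 2, 3, 2, 1, 0, 1, 2, 3, 0, 1, 0, 3, 2, 1, 2, 3,
      0, 1, 2, 1, 0, 3, 0, 1, 2, 3, 0, 3, 2, 1, 2, 3, 0, 1, 0, 3, 2, 1, 0, 1, 2, 3, 2, 1, 0, 3, 0, 1, 2, 1,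
      0, 3, 2, 1, 2, 3, 0, 1, 0, 3, 2, 1, 0, 1, 2, 3, 0, 3, 2, 1, 0, 3, 0, 1, 2, 3, 2, 1, 0, 1, 2, 3, 0, 1,
      0, 3, 2, 1, 2, 3, 0, 3, 2, 1, 0, 1, 2, 3, 2, 1, 0, 3, 0, 1, 2, 1, 0, 3, 2, 1, 2, 3, 0, 1, 0, 3, 2, 1]
  | 3 =>
     [0, 1, 2, 3, 0, 3, 2, 1, 2, 3, 0, 1, 2, 1, 0, 3, 0, 1, 2, 3, 2, 1, 0, 1, 2, 3, 0, 1, 0, 3, 2, 1, 2, 3,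
      0, 1, 2, 1, 0, 3, 0, 1, 2, 3, 0, 3, 2, 1, 2, 3, 0, 1, 0, 3, 2, 1, 0, 1, 2, 3, 0, 3, 2, 1, 0, 3, 0, 1,
      2, 3, 2, 1, 0, 1, 2, 3, 0, 1, 0, 3, 2, 1, 2, 3, 0, 3, 2, 1, 0, 1, 2, 3, 2, 1, 0, 3, 0, 1, 2, 3, 0, 3,
      2, 1, 2, 3, 0, 1, 0, 3, 2, 1, 0, 1, 2, 3, 2, 1, 0, 3, 0, 1, 2, 1, 0, 3, 2, 1, 2, 3, 0, 1, 0, 3, 2, 1]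

theorem deanBlock_length (a : Fin 4) : (deanBlock a).length = 136 := by
  fin_cases a <;> rfl

/-- The image of a finite word under the morphism. -/
def deanImage (w : List (Fin 4)) : List (Fin 4) :=
  w.flatMap deanBlock

/-- The image of an infinite word: the concatenation of the blocks of length 136
`deanBlock (w 0)`, `deanBlock (w 1)`, … -/
def deanImageInf (w : ℕ → Fin 4) (n : ℕ) : Fin 4 :=
  (deanBlock (w (n / 136)))[n % 136]'(by
    rw [deanBlock_length]; exact Nat.mod_lt n (by norm_num))

/-! Everything rests on a condition between the two bounds, `StronglyFree`: an overlap `x` of period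
`p` has `3 * x + 2 ≤ 2 * p`. It follows from `7/5⁺`-freeness and suffices for the 136-uniform
morphism. It is also preserved by a 22-uniform morphism, whose fixed point thus replaces an infinite
`7/5⁺`-free word in part (1).

Long overlaps in an image contain a marker, a block prefix that occurs only at block boundaries. So
the period is a multiple `q * p'` of the block length, and the repetition desubstitutes to one with
overlap `x'`, where `x ≤ q * x' + c₁ + c₂`; the `2` in `StronglyFree` absorbs `c₁ + c₂`
(`exists_repetition_of_uniformImage`). Short overlaps have small periods, so they lie in images of a
few letters. Three consecutive letters of a strongly free word are distinct, which leaves finitely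
many words to test. Words are encoded by two bit masks so that the tests become arithmetic on large
numbers. -/

/-! ### Computable tests on bit masks -/

/-- The words of length `m` over `{0, 1, 2, 3}` in which any three consecutive letters are
distinct. -/
def locallyDistinctWords : ℕ → List (List (Fin 4))
  | 0 => [[]]
  | m + 1 => (locallyDistinctWords m).flatMap fun u =>
      ([0, 1, 2, 3].filter fun a => !(u.take 2).elem a).map (· :: u)

/-- The number whose binary digits, from the least significant one on, are the values of `f` at
the letters of the word. -/
def digitMask {α : Type*} (f : α → Bool) : List α → ℕ
  | [] => 0
  | a :: l => (f a).toNat + 2 * digitMask f l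

/-- The number in which bit `j` is set iff the letters of numbers `j` and `j + p` differ, for the
word given by its two digit masks. -/
def mismatchMask (A B p : ℕ) : ℕ :=
  Nat.lor (Nat.xor A (Nat.shiftRight A p)) (Nat.xor B (Nat.shiftRight B p))

/-- Application of `f` to `n`, written so that kernel reduction evaluates `n` first. -/
def evalFirst {α : Type*} (n : ℕ) (f : ℕ → α) : α :=
  match n with
  | 0 => f 0
  | n + 1 => f n.succ

/-- Disjunction of the shifts of `E` by less than `t`, if `fuel` is large enough. -/
def smear : ℕ → ℕ → ℕ → ℕ
  | 0, E, _ => E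
  | fuel + 1, E, t => evalFirst (Nat.lor E (Nat.shiftRight E (Nat.div t 2))) fun E =>
      evalFirst (Nat.sub t (Nat.div t 2)) (smear fuel E)

/-- A sufficient test for the word of length `len` with digit masks `A` and `B` to have no
repetition with period `p` and length `p + t`. -/
def noRepetitionTest (A B len p t : ℕ) : Bool :=
  evalFirst (Nat.pow 2 (len + 1 - (p + t))) fun n =>
    Nat.beq (Nat.mod (smear 8 (mismatchMask A B p) t) n) (Nat.pred n)

/-- The digit mask of the image of a word under a `q`-uniform morphism. -/
def imageMask (f : Fin 4 → Bool) (block : Fin 4 → List (Fin 4)) (q : ℕ) : List (Fin 4) → ℕ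
  | [] => 0
  | a :: u => digitMask f (block a) + Nat.pow 2 q * imageMask f block q u

/-- The low bit of the binary expansion of a letter. -/
def lowBit (a : Fin 4) : Bool := a.val.testBit 0

/-- The high bit of the binary expansion of a letter. -/
def highBit (a : Fin 4) : Bool := a.val.testBit 1

/-- No image of a locally distinct word of length at most `M` contains a repetition with
period `p < N` and length `p + T p`. If the image is so long that the repetition would lie in the
image of a shorter word, nothing is tested. -/
def noShortRepetitionTest (block : Fin 4 → List (Fin 4)) (q : ℕ) (T : ℕ → ℕ) (M N : ℕ) : Bool :=
  (List.range (M + 1)).all fun m => (locallyDistinctWords m).all fun u =>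
    evalFirst (imageMask lowBit block q u) fun A =>
    evalFirst (imageMask highBit block q u) fun B =>
      (List.range N).all fun p => evalFirst p fun p => evalFirst (T p) fun t =>
        Nat.beq p 0 || Nat.ble (p + t + 2 * q) (q * m) || noRepetitionTest A B (q * m) p t

/-- In the images of locally distinct words of length at most two, the prefixes of length `l` of
the blocks occur at the beginning of the blocks only. -/
def markerTest (block : Fin 4 → List (Fin 4)) (q l : ℕ) : Bool :=
  evalFirst (Nat.pow 2 l) fun n =>
  (List.range 3).all fun m => (locallyDistinctWords m).all fun u =>
    evalFirst (imageMask lowBit block q u) fun A =>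
    evalFirst (imageMask highBit block q u) fun B =>
      (List.range q).all fun r => Nat.beq r 0 || [0, 1, 2, 3].all fun b =>
        !(Nat.beq (Nat.mod (Nat.shiftRight A r) n) (Nat.mod (digitMask lowBit (block b)) n) &&
          Nat.beq (Nat.mod (Nat.shiftRight B r) n) (Nat.mod (digitMask highBit (block b)) n))

/-- The image of each letter under a 22-uniform morphism. -/
def shortBlock : Fin 4 → List (Fin 4)
  | 0 => [0, 1, 2, 3, 1, 0, 2, 1, 3, 0, 1, 2, 3, 0, 2, 1, 3, 2, 0, 1, 2, 3]
  | 1 => [0, 1, 3, 2, 1, 0, 3, 1, 2, 0, 1, 3, 2, 0, 3, 1, 2, 3, 0, 1, 3, 2]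
  | 2 => [1, 0, 2, 3, 0, 1, 2, 0, 3, 1, 0, 2, 3, 1, 2, 0, 3, 2, 1, 0, 2, 3]
  | 3 => [1, 0, 3, 2, 0, 1, 3, 0, 2, 1, 0, 3, 2, 1, 3, 0, 2, 3, 1, 0, 3, 2]

set_option maxRecDepth 100000

/-- `(2 * p + 1) / 3` is the least `x` with `3 * x + 2 > 2 * p`. Without a guaranteed marker `x ≤
28`, so a violation has `p < 43` and length at most 70, and meets at most 5 blocks. -/
theorem shortBlock_noShortRepetition :
    noShortRepetitionTest shortBlock 22 (fun p => (2 * p + 1) / 3) 5 43 = true := by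
  decide +kernel

theorem shortBlock_marker : markerTest shortBlock 22 8 = true := by
  decide +kernel

/-- `2 * p / 3 + 1` is the least `x` with `3 * x > 2 * p`. Here `x ≤ 147`, so `p < 221`, the length
is at most 367, and 4 blocks suffice. -/
theorem deanBlock_noShortRepetition :
    noShortRepetitionTest deanBlock 136 (fun p => 2 * p / 3 + 1) 4 221 = true := by
  decide +kernel

theorem deanBlock_marker : markerTest deanBlock 136 13 = true := by
  decide +kernel

/-! ### Soundness of the bit mask operations -/

theorem evalFirst_eq {α : Type*} (n : ℕ) (f : ℕ → α) : evalFirst n f = f n := by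
  cases n <;> rfl

theorem mismatchMask_eq (A B p : ℕ) :
    mismatchMask A B p = (A ^^^ (A >>> p)) ||| (B ^^^ (B >>> p)) := rfl

/-- This direction needs no bound on `fuel`: too little fuel only sets fewer bits, which makes the
test stricter. -/
theorem exists_testBit_of_testBit_smear (fuel : ℕ) : ∀ (E t i : ℕ), 0 < t →
    (smear fuel E t).testBit i = true → ∃ s < t, E.testBit (i + s) = true := by
  induction fuel with
  | zero => exact fun E t i ht h => ⟨0, ht, h⟩
  | succ fuel ih =>
    intro E t i ht h
    simp only [smear, evalFirst_eq] at h
    change (smear fuel (E ||| (E >>> (t / 2))) (t - t / 2)).testBit i = true at h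
    obtain ⟨s, hs, h⟩ := ih _ _ _ (by omega) h
    rw [Nat.testBit_or, Nat.testBit_shiftRight, Bool.or_eq_true] at h
    rcases h with h | h
    · exact ⟨s, by omega, h⟩
    · exact ⟨s + t / 2, by omega, by rwa [show i + (s + t / 2) = t / 2 + (i + s) by omega]⟩

/-- Bits past the end of the word are 0, so the default letter must have digit 0 as well. -/
theorem testBit_digitMask {f : Fin 4 → Bool} (hf : f 0 = false) (l : List (Fin 4)) (j : ℕ) :
    (digitMask f l).testBit j = f (l.getD j 0) := by
  induction l generalizing j with
  | nil => simp [digitMask, hf]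
  | cons a l ih =>
    cases j with
    | zero => cases h : f a <;> simp [digitMask, h]
    | succ j =>
      rw [Nat.testBit_succ, List.getD_cons_succ, ← ih]
      congr 1
      cases h : f a
      · simp [digitMask, h]
      · simp only [digitMask, h, Bool.toNat_true]; omega

theorem digitMask_append (f : Fin 4 → Bool) (l l' : List (Fin 4)) :
    digitMask f (l ++ l') = digitMask f l + 2 ^ l.length * digitMask f l' := by
  induction l with
  | nil => simp [digitMask]
  | cons a l ih => simp [digitMask, ih, pow_succ]; ring

theorem imageMask_eq {q : ℕ} {block : Fin 4 → List (Fin 4)} (hq : ∀ a, (block a).length = q)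
    (f : Fin 4 → Bool) (u : List (Fin 4)) :
    imageMask f block q u = digitMask f (u.flatMap block) := by
  induction u with
  | nil => rfl
  | cons a u ih =>
    rw [List.flatMap_cons, digitMask_append, imageMask, ih, hq]
    rfl

/-- If the test succeeds, then no repetition is found. -/
theorem exists_mismatch_of_noRepetitionTest {l : List (Fin 4)} {p t r : ℕ} (ht : 0 < t)
    (h : noRepetitionTest (digitMask lowBit l) (digitMask highBit l) l.length p t = true)
    (hr : r + p + t ≤ l.length) : ∃ s < t, l.getD (r + s) 0 ≠ l.getD (r + p + s) 0 := by
  simp only [noRepetitionTest, evalFirst_eq] at h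
  have h' : smear 8 (mismatchMask (digitMask lowBit l) (digitMask highBit l) p) t %
      2 ^ (l.length + 1 - (p + t)) = 2 ^ (l.length + 1 - (p + t)) - 1 := Nat.eq_of_beq_eq_true h
  have h2 := congrArg (Nat.testBit · r) h'
  simp only [Nat.testBit_mod_two_pow, Nat.testBit_two_pow_sub_one] at h2
  rw [decide_eq_true (show r < l.length + 1 - (p + t) by omega), Bool.true_and] at h2
  obtain ⟨s, hs, h3⟩ := exists_testBit_of_testBit_smear _ _ _ _ ht h2
  refine ⟨s, hs, fun heq => ?_⟩
  rw [mismatchMask_eq, Nat.testBit_or, Nat.testBit_xor, Nat.testBit_xor, Nat.testBit_shiftRight,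
    Nat.testBit_shiftRight, testBit_digitMask rfl, testBit_digitMask rfl, testBit_digitMask rfl,
    testBit_digitMask rfl, show p + (r + s) = r + p + s by omega, heq] at h3
  simp at h3

/-! ### Images of infinite words and transfer of the tests -/

/-- The letter of number `n` of the image of the infinite word `w` under a `q`-uniform morphism. -/
def uniformImage (block : Fin 4 → List (Fin 4)) (q : ℕ) (w : ℕ → Fin 4) (n : ℕ) : Fin 4 :=
  (block (w (n / q))).getD (n % q) 0

/-- In the prefix of `w` of length `n`, each factor of length `p + x` with period `p` satisfies
`3 * x + 2 ≤ 2 * p`. -/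
def StronglyFree (w : ℕ → Fin 4) (n : ℕ) : Prop :=
  ∀ i p x, 0 < p → i + p + x ≤ n → (∀ s < x, w (i + s) = w (i + p + s)) → 3 * x + 2 ≤ 2 * p

/-- The factor of `w` of length `m` at position `k`. -/
def window (w : ℕ → Fin 4) : ℕ → ℕ → List (Fin 4)
  | _, 0 => []
  | k, m + 1 => w k :: window w (k + 1) m

theorem length_flatMap_window {q : ℕ} {block : Fin 4 → List (Fin 4)}
    (hq : ∀ a, (block a).length = q) (w : ℕ → Fin 4) (k m : ℕ) :
    ((window w k m).flatMap block).length = q * m := by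
  induction m generalizing k with
  | zero => rfl
  | succ m ih => rw [window, List.flatMap_cons, List.length_append, ih, hq]; ring

theorem uniformImage_eq_getD {q : ℕ} {block : Fin 4 → List (Fin 4)}
    (hq : ∀ a, (block a).length = q) (w : ℕ → Fin 4) (k m s : ℕ) (hs : s < q * m) :
    uniformImage block q w (q * k + s) = ((window w k m).flatMap block).getD s 0 := by
  induction m generalizing k s with
  | zero => omega
  | succ m ih =>
    have q0 : 0 < q := Nat.pos_of_ne_zero (by rintro rfl; simp at hs)
    rw [window, List.flatMap_cons]
    by_cases h : s < q
    · rw [List.getD_append _ _ _ _ (by rwa [hq]), uniformImage, Nat.mul_add_div q0,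
        Nat.div_eq_of_lt h, Nat.mul_add_mod, Nat.mod_eq_of_lt h, add_zero]
    · rw [List.getD_append_right _ _ _ _ (by rw [hq]; omega), hq, ← ih _ _ (by
        rw [Nat.mul_succ] at hs; omega)]
      congr 1
      rw [Nat.mul_succ]; omega

theorem window_mem_locallyDistinctWords {w : ℕ → Fin 4} {n : ℕ} (hw : StronglyFree w n)
    (k m : ℕ) (hk : k + m ≤ n) : window w k m ∈ locallyDistinctWords m := by
  have key : ∀ j p, 0 < p → p ≤ 2 → j + p + 1 ≤ n → w j ≠ w (j + p) := by
    intro j p hp hp2 hj heq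
    have := hw j p 1 hp hj (by simpa using heq)
    omega
  induction m generalizing k with
  | zero => simp [window, locallyDistinctWords]
  | succ m ih =>
    simp only [window, locallyDistinctWords, List.mem_flatMap, List.mem_map, List.mem_filter]
    refine ⟨_, ih (k + 1) (by omega), _, ⟨?_, ?_⟩, rfl⟩
    · generalize w k = a
      revert a; decide
    · rcases m with _ | _ | m
      · rfl
      · have h1 := key k 1 (by omega) (by omega) (by omega)
        simp [window, h1]
      · have h1 := key k 1 (by omega) (by omega) (by omega)
        have h2 := key k 2 (by omega) (by omega) (by omega)
        simp [window, h1, h2, add_assoc]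

/-- Each factor of length `s` of the image occurs in the image of a short locally distinct word. -/
theorem exists_locallyDistinctWord {q : ℕ} {block : Fin 4 → List (Fin 4)} (q0 : 0 < q)
    (hq : ∀ a, (block a).length = q) {w : ℕ → Fin 4} {n : ℕ} (hw : StronglyFree w n)
    {i s M : ℕ} (hi : i + s ≤ q * n) (hs : s + q ≤ q * M + 1) :
    ∃ m ≤ M, ∃ u ∈ locallyDistinctWords m, (u.flatMap block).length = q * m ∧
      i % q + s ≤ q * m ∧ q * m < s + 2 * q ∧
      ∀ t < s, uniformImage block q w (i + t) = (u.flatMap block).getD (i % q + t) 0 := by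
  have hdm := Nat.div_add_mod i q
  have hlt := Nat.mod_lt i q0
  obtain ⟨m, hm1, hm2⟩ : ∃ m, i % q + s ≤ q * m ∧ q * m < i % q + s + q := by
    refine ⟨(i % q + s + q - 1) / q, ?_, ?_⟩
    · have := Nat.div_add_mod (i % q + s + q - 1) q
      have := Nat.mod_lt (i % q + s + q - 1) q0
      omega
    · have := Nat.div_add_mod (i % q + s + q - 1) q
      omega
  refine ⟨m, ?_, window w (i / q) m, window_mem_locallyDistinctWords hw _ _ ?_,
    length_flatMap_window hq _ _ _, hm1, by omega, fun t ht => ?_⟩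
  · have : q * m < q * (M + 1) := by rw [Nat.mul_succ]; omega
    have := Nat.lt_of_mul_lt_mul_left this
    omega
  · have : q * (i / q + m) < q * (n + 1) := by rw [Nat.mul_succ, Nat.mul_add]; omega
    have := Nat.lt_of_mul_lt_mul_left this
    omega
  · rw [← uniformImage_eq_getD hq _ _ _ _ (by omega)]
    congr 1
    omega

theorem mod_eq_zero_of_markerTest {q l : ℕ} {block : Fin 4 → List (Fin 4)} (q0 : 0 < q)
    (hq : ∀ a, (block a).length = q) (hl : l ≤ q) (test : markerTest block q l = true)
    {w : ℕ → Fin 4} {n : ℕ} (hw : StronglyFree w n) {i : ℕ} (hi : i + l ≤ q * n) (b : Fin 4)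
    (h : ∀ t < l, uniformImage block q w (i + t) = (block b).getD t 0) : i % q = 0 := by
  obtain ⟨m, hm, u, hu, -, -, -, hu'⟩ := exists_locallyDistinctWord q0 hq (M := 2) hw hi (by omega)
  simp only [markerTest, evalFirst_eq, List.all_eq_true] at test
  have test := test m (List.mem_range.2 (by omega)) u hu (i % q)
    (List.mem_range.2 (Nat.mod_lt _ q0))
  rw [Bool.or_eq_true, List.all_eq_true, imageMask_eq hq, imageMask_eq hq] at test
  rcases test with test | test
  · exact Nat.eq_of_beq_eq_true test
  · exfalso
    have test := test b (by clear * -; revert b; decide)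
    have key : ∀ f : Fin 4 → Bool, f 0 = false →
        Nat.mod (Nat.shiftRight (digitMask f (u.flatMap block)) (i % q)) (Nat.pow 2 l) =
          Nat.mod (digitMask f (block b)) (Nat.pow 2 l) := by
      intro f hf
      change (digitMask f (u.flatMap block) >>> (i % q)) % 2 ^ l = digitMask f (block b) % 2 ^ l
      apply Nat.eq_of_testBit_eq
      intro j
      rw [Nat.testBit_mod_two_pow, Nat.testBit_mod_two_pow, Nat.testBit_shiftRight,
        testBit_digitMask hf, testBit_digitMask hf]
      by_cases hj : j < l
      · rw [← hu' j hj, h j hj]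
      · simp [hj]
    -- Both masks agree with those of the marker at offset `i % q`, which the test excludes for a
    -- nonzero offset.
    rw [key _ rfl, key _ rfl] at test
    simp at test

theorem exists_mismatch_of_noShortRepetitionTest {q M N : ℕ} {T : ℕ → ℕ}
    {block : Fin 4 → List (Fin 4)} (q0 : 0 < q) (hq : ∀ a, (block a).length = q)
    (test : noShortRepetitionTest block q T M N = true)
    {w : ℕ → Fin 4} {n : ℕ} (hw : StronglyFree w n) {i p : ℕ} (hp : 0 < p) (hpN : p < N)
    (hT : 0 < T p) (hM : p + T p + q ≤ q * M + 1) (hi : i + p + T p ≤ q * n) :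
    ∃ s < T p, uniformImage block q w (i + s) ≠ uniformImage block q w (i + p + s) := by
  obtain ⟨m, hm, u, hu, hlen, hb₁, hb₂, hu'⟩ :=
    exists_locallyDistinctWord q0 hq (i := i) (s := p + T p) hw (by omega) hM
  simp only [noShortRepetitionTest, evalFirst_eq, List.all_eq_true] at test
  have test := test m (List.mem_range.2 (by omega)) u hu p (List.mem_range.2 hpN)
  rw [Bool.or_eq_true, Bool.or_eq_true, imageMask_eq hq, imageMask_eq hq, ← hlen] at test
  rcases test with (test | test) | test
  · exact absurd (Nat.eq_of_beq_eq_true test) hp.ne'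
  · have := Nat.le_of_ble_eq_true test
    omega
  · obtain ⟨s, hs, hne⟩ := exists_mismatch_of_noRepetitionTest (r := i % q) hT test (by omega)
    refine ⟨s, hs, ?_⟩
    rwa [hu' s (by omega), add_assoc i, hu' (p + s) (by omega), ← add_assoc]

/-! ### Desubstitution of long repetitions -/

/-- A long repetition in the image comes from a repetition in the preimage. -/
theorem exists_repetition_of_uniformImage {q l c₁ c₂ : ℕ} {block : Fin 4 → List (Fin 4)}
    (q0 : 0 < q) (hq : ∀ a, (block a).length = q) (hl : l ≤ q)
    (test : markerTest block q l = true)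
    (hpre : ∀ a b, a ≠ b → ∃ t < q, t ≤ c₁ ∧ (block a).getD t 0 ≠ (block b).getD t 0)
    (hsuf : ∀ a b, a ≠ b → ∃ t < q, q ≤ t + c₂ + 1 ∧ (block a).getD t 0 ≠ (block b).getD t 0)
    {w : ℕ → Fin 4} {n : ℕ} (hw : StronglyFree w n) {i p x : ℕ} (hp : 0 < p)
    (hi : i + p + x ≤ q * n) (hx : q + l ≤ x + 1)
    (h : ∀ s < x, uniformImage block q w (i + s) = uniformImage block q w (i + p + s)) :
    ∃ p' x', p = q * p' ∧ 3 * x' + 2 ≤ 2 * p' ∧ x ≤ q * x' + c₁ + c₂ := by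
  have himg : ∀ j t, t < q → uniformImage block q w (q * j + t) = (block (w j)).getD t 0 := by
    intro j t ht
    rw [uniformImage, Nat.mul_add_div q0, Nat.div_eq_of_lt ht, Nat.mul_add_mod,
      Nat.mod_eq_of_lt ht, add_zero]
  -- `k` is the first block starting at or after `i`; by `hx` its marker lies within the overlap.
  obtain ⟨k, hk1, hk2⟩ : ∃ k, i ≤ q * k ∧ q * k < i + q := by
    refine ⟨(i + q - 1) / q, ?_, ?_⟩
    · have := Nat.div_add_mod (i + q - 1) q
      have := Nat.mod_lt (i + q - 1) q0
      omega
    · have := Nat.div_add_mod (i + q - 1) q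
      omega
  obtain ⟨p', rfl⟩ : q ∣ p := by
    have h0 : (q * k + p) % q = 0 := by
      refine mod_eq_zero_of_markerTest q0 hq hl test hw (by omega) (w k) fun t ht => ?_
      rw [← himg k t (by omega), show q * k + t = i + (q * k - i + t) by omega,
        h _ (by omega)]
      congr 1
      omega
    rw [Nat.mul_add_mod] at h0
    exact Nat.dvd_of_mod_eq_zero h0
  have hp' : 0 < p' := Nat.pos_of_mul_pos_left hp
  have hD : ∀ j t, t < q → i ≤ q * j + t → q * j + t < i + x →
      (block (w j)).getD t 0 = (block (w (j + p'))).getD t 0 := by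
    intro j t ht h1 h2
    rw [← himg j t ht, ← himg _ t ht, show q * j + t = i + (q * j + t - i) by omega,
      h _ (by omega), Nat.mul_add]
    congr 1
    omega
  have hmono : ∀ {a b : ℕ}, q * a < q * b → a < b := fun h => Nat.lt_of_mul_lt_mul_left h
  -- The block cut by the left end either matches its translate, and is included, or differs within
  -- its last `c₂ + 1` letters, so that the overlap covers at most `c₂` of them.
  obtain ⟨kL, hL1, hL2, hL3⟩ : ∃ kL ≤ k, q * kL ≤ i + c₂ ∧
      ∀ j, kL ≤ j → j < k → w j = w (j + p') := by
    rcases k with _ | k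
    · exact ⟨0, le_rfl, by omega, by omega⟩
    rw [Nat.mul_succ] at hk1 hk2
    by_cases heq : w k = w (k + p')
    · refine ⟨k, by omega, by omega, fun j h1 h2 => ?_⟩
      obtain rfl : j = k := by omega
      exact heq
    · refine ⟨k + 1, le_rfl, ?_, by omega⟩
      obtain ⟨t, ht, ht2, hne⟩ := hsuf _ _ heq
      rw [Nat.mul_succ]
      by_contra hcon
      exact hne (hD k t ht (by omega) (by omega))
  obtain ⟨k₂, hk₂1, hk₂2⟩ : ∃ k₂, q * k₂ ≤ i + x ∧ i + x < q * k₂ + q :=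
    ⟨(i + x) / q, Nat.mul_div_le _ _, by
      have := Nat.div_add_mod (i + x) q
      have := Nat.mod_lt (i + x) q0
      omega⟩
  have hkk : k ≤ k₂ := by
    have : q * k < q * (k₂ + 1) := by rw [Nat.mul_succ]; omega
    have := hmono this
    omega
  -- The same at the right end, with prefixes and `c₁`.
  obtain ⟨kR, hR1, hR2, hR3, hR4⟩ : ∃ kR, k₂ ≤ kR ∧ i + x ≤ q * kR + c₁ ∧ kR + p' ≤ n ∧
      ∀ j, k₂ ≤ j → j < kR → w j = w (j + p') := by
    have hn : k₂ + p' ≤ n := by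
      have : q * (k₂ + p') < q * (n + 1) := by rw [Nat.mul_succ, Nat.mul_add]; omega
      have := hmono this
      omega
    by_cases hlt : i + x = q * k₂
    · exact ⟨k₂, le_rfl, by omega, hn, by omega⟩
    by_cases heq : w k₂ = w (k₂ + p')
    · refine ⟨k₂ + 1, by omega, by rw [Nat.mul_succ]; omega, ?_, fun j h1 h2 => ?_⟩
      · have : q * (k₂ + p') < q * n := by rw [Nat.mul_add]; omega
        have := hmono this
        omega
      · obtain rfl : j = k₂ := by omega
        exact heq
    · refine ⟨k₂, le_rfl, ?_, hn, by omega⟩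
      obtain ⟨t, ht, ht2, hne⟩ := hpre _ _ heq
      by_contra hcon
      have : q * k ≤ q * k₂ := Nat.mul_le_mul_left q hkk
      exact hne (hD k₂ t ht (by omega) (by omega))
  have hM : ∀ j, k ≤ j → j < k₂ → w j = w (j + p') := by
    intro j h1 h2
    by_contra hne
    obtain ⟨t, ht, -, hne⟩ := hpre _ _ hne
    have h3 : q * k ≤ q * j := Nat.mul_le_mul_left q h1
    have h4 : q * (j + 1) ≤ q * k₂ := Nat.mul_le_mul_left q h2
    rw [Nat.mul_succ] at h4
    exact hne (hD j t ht (by omega) (by omega))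
  refine ⟨p', kR - kL, rfl, hw kL p' (kR - kL) hp' (by omega) fun s hs => ?_, ?_⟩
  · rw [show kL + p' + s = kL + s + p' by omega]
    by_cases h1 : kL + s < k
    · exact hL3 _ (by omega) h1
    by_cases h2 : kL + s < k₂
    · exact hM _ (by omega) h2
    · exact hR4 _ (by omega) (by omega)
  · have : q * kR = q * (kR - kL) + q * kL := by rw [← Nat.mul_add]; congr 1; omega
    omega

/-! ### The two morphisms -/

theorem shortBlock_length (a : Fin 4) : (shortBlock a).length = 22 := by
  fin_cases a <;> rfl

theorem shortBlock_prefix (a b : Fin 4) (h : a ≠ b) :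
    ∃ t < 22, t ≤ 2 ∧ (shortBlock a).getD t 0 ≠ (shortBlock b).getD t 0 := by
  revert a b; decide +kernel

theorem shortBlock_suffix (a b : Fin 4) (h : a ≠ b) :
    ∃ t < 22, 22 ≤ t + 2 + 1 ∧ (shortBlock a).getD t 0 ≠ (shortBlock b).getD t 0 := by
  revert a b; decide +kernel

theorem deanBlock_prefix (a b : Fin 4) (h : a ≠ b) :
    ∃ t < 136, t ≤ 60 ∧ (deanBlock a).getD t 0 ≠ (deanBlock b).getD t 0 := by
  revert a b; decide +kernel

theorem deanBlock_suffix (a b : Fin 4) (h : a ≠ b) :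
    ∃ t < 136, 136 ≤ t + 28 + 1 ∧ (deanBlock a).getD t 0 ≠ (deanBlock b).getD t 0 := by
  revert a b; decide +kernel

theorem stronglyFree_shortBlock {w : ℕ → Fin 4} {n : ℕ} (hw : StronglyFree w n) :
    StronglyFree (uniformImage shortBlock 22 w) (22 * n) := by
  intro i p x hp hi h
  by_contra hcon
  by_cases hx : 22 + 8 ≤ x + 1
  · obtain ⟨p', x', rfl, h1, h2⟩ := exists_repetition_of_uniformImage (by norm_num)
      shortBlock_length (by norm_num) shortBlock_marker shortBlock_prefix shortBlock_suffix hw hp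
      hi hx h
    -- The slack suffices: `3 * (2 + 2) + 2 ≤ 2 * 22`.
    omega
  · obtain ⟨s, hs, hne⟩ := exists_mismatch_of_noShortRepetitionTest (i := i) (p := p)
      (by norm_num) shortBlock_length shortBlock_noShortRepetition hw hp (by omega)
      (by omega) (by omega) (by omega)
    exact hne (h s (by omega))

theorem three_mul_le_of_deanBlock {w : ℕ → Fin 4} {n : ℕ} (hw : StronglyFree w n) {i p x : ℕ}
    (hp : 0 < p) (hi : i + p + x ≤ 136 * n)
    (h : ∀ s < x, uniformImage deanBlock 136 w (i + s) = uniformImage deanBlock 136 w (i + p + s)) :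
    3 * x ≤ 2 * p := by
  by_contra hcon
  by_cases hx : 136 + 13 ≤ x + 1
  · obtain ⟨p', x', rfl, h1, h2⟩ := exists_repetition_of_uniformImage (by norm_num)
      deanBlock_length (by norm_num) deanBlock_marker deanBlock_prefix deanBlock_suffix hw hp
      hi hx h
    -- The slack suffices, narrowly: `3 * (60 + 28) = 264 ≤ 272 = 2 * 136`.
    omega
  · obtain ⟨s, hs, hne⟩ := exists_mismatch_of_noShortRepetitionTest (i := i) (p := p)
      (by norm_num) deanBlock_length deanBlock_noShortRepetition hw hp (by omega)
      (by omega) (by omega) (by omega)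
    exact hne (h s (by omega))

/-! ### An infinite strongly free word -/

/-- The fixed point of the 22-uniform morphism. -/
def shortBlockFixedPoint (n : ℕ) : Fin 4 :=
  if h : n = 0 then 0 else (shortBlock (shortBlockFixedPoint (n / 22))).getD (n % 22) 0
termination_by n
decreasing_by omega

theorem uniformImage_shortBlockFixedPoint :
    uniformImage shortBlock 22 shortBlockFixedPoint = shortBlockFixedPoint := by
  funext n
  by_cases h : n = 0
  · subst h
    rw [uniformImage, Nat.zero_div, shortBlockFixedPoint, dif_pos rfl]
    rfl
  · conv_rhs => rw [shortBlockFixedPoint, dif_neg h]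
    rfl

theorem stronglyFree_shortBlockFixedPoint (n : ℕ) : StronglyFree shortBlockFixedPoint n := by
  have key : ∀ k, StronglyFree shortBlockFixedPoint (22 ^ k) := by
    intro k
    induction k with
    -- A prefix of length 1 forces `p = 1` and `x = 0`, where equality holds.
    | zero => intro i p x hp hi _; omega
    | succ k ih =>
      have := stronglyFree_shortBlock ih
      rwa [uniformImage_shortBlockFixedPoint, ← pow_succ'] at this
  intro i p x hp hi h
  exact key n i p x hp (hi.trans (Nat.lt_pow_self (by norm_num)).le) h

/-! ### From letters to sets of factors -/

/-- The factors excluded from reduced words that avoid `323`. -/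
def forbiddenFactors : List (List (Fin 4)) := [[0, 2], [2, 0], [1, 3], [3, 1], [3, 2, 3]]

theorem deanBlock_avoids : ∀ m < 3, ∀ u ∈ locallyDistinctWords m, ∀ v ∈ forbiddenFactors,
    ¬ v <:+: u.flatMap deanBlock := by
  decide +kernel

theorem deanImageInf_eq (w : ℕ → Fin 4) : deanImageInf w = uniformImage deanBlock 136 w := by
  funext n
  rw [deanImageInf, uniformImage, List.getD_eq_getElem]

/-- The factor of length `m` at position `i` of the infinite word `w`. -/
def factorAt {α : Type*} (w : ℕ → α) (i m : ℕ) : List α :=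
  (List.range m).map fun j => w (i + j)

theorem getElem?_factorAt {α : Type*} {w : ℕ → α} {i m j : ℕ} (h : j < m) :
    (factorAt w i m)[j]? = some (w (i + j)) := by
  simp [factorAt, h]

theorem length_factorAt {α : Type*} (w : ℕ → α) (i m : ℕ) : (factorAt w i m).length = m := by
  simp [factorAt]

theorem factorAt_hasPeriod {α : Type*} {w : ℕ → α} {i p x : ℕ} :
    (factorAt w i (p + x)).HasPeriod p ↔ ∀ s < x, w (i + s) = w (i + p + s) := by
  rw [List.hasPeriod_iff_getElem?, length_factorAt, Nat.add_sub_cancel_left]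
  refine forall₂_congr fun s hs => ?_
  rw [getElem?_factorAt (by omega), getElem?_factorAt (by omega), Option.some_inj,
    show i + (s + p) = i + p + s by omega]

theorem infix_of_getD {u L : List (Fin 4)} {r : ℕ} (hr : r + u.length ≤ L.length)
    (h : ∀ t < u.length, u.getD t 0 = L.getD (r + t) 0) : u <:+: L := by
  have : u = (L.drop r).take u.length := by
    apply List.ext_getElem
    · simp; omega
    · intro t h1 h2
      have := h t h1
      rw [List.getD_eq_getElem _ _ h1, List.getD_eq_getElem _ _ (by omega)] at this
      simpa using this
  rw [this]
  exact ((List.take_prefix _ _).isInfix).trans (List.drop_suffix _ _).isInfix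

/-- The conclusions for all sets of factors of images of strongly free words. -/
theorem dean_of_stronglyFree {w : ℕ → Fin 4} {F : Set (List (Fin 4))}
    (hF : ∀ u ∈ F, ∃ i m n, u = factorAt (uniformImage deanBlock 136 w) i m ∧
      i + m ≤ 136 * n ∧ StronglyFree w n) :
    DeanWord F ∧ PlusFree (5 / 3) F ∧ Avoids F [3, 2, 3] := by
  have havoid : ∀ v ∈ forbiddenFactors, v ∉ F := by
    intro v hv hvF
    obtain ⟨i, m, n, hu, hi, hw⟩ := hF v hvF
    have hlen : v.length = m := by rw [hu, length_factorAt]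
    have hm : m ≤ 3 := by
      rw [← hlen]
      clear * - hv
      revert v; decide
    obtain ⟨k, hk, u, huk, hul, hb, -, hu'⟩ :=
      exists_locallyDistinctWord (M := 2) (by norm_num) deanBlock_length hw hi (by omega)
    refine deanBlock_avoids k (by omega) u huk v hv (infix_of_getD (r := i % 136) (by omega) ?_)
    intro t ht
    rw [← hu' t (by omega), List.getD_eq_getElem?_getD, hu, getElem?_factorAt (by omega)]
    rfl
  have hfree : PlusFree (5 / 3) F := by
    intro u hu p hp hper
    obtain ⟨i, m, n, rfl, hi, hw⟩ := hF u hu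
    rw [length_factorAt, div_le_iff₀ (by exact_mod_cast hp)]
    have key : 3 * m ≤ 5 * p := by
      by_cases hpm : p ≤ m
      · obtain ⟨x, rfl⟩ := Nat.exists_eq_add_of_le hpm
        have := three_mul_le_of_deanBlock hw hp (by omega) (factorAt_hasPeriod.1 hper)
        omega
      · omega
    have : (3 * m : ℚ) ≤ 5 * p := by exact_mod_cast key
    linarith
  refine ⟨⟨⟨?_, ?_, ?_, ?_⟩, ?_⟩, hfree, ?_⟩
  any_goals exact havoid _ (by decide)
  intro u hu huF
  have hpos : 0 < u.length := List.length_pos_iff.2 hu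
  -- A square has exponent 2, which exceeds 5/3.
  have := hfree _ huF u.length hpos (by simp [List.HasPeriod])
  rw [List.length_append, div_le_iff₀ (by exact_mod_cast hpos)] at this
  have hpos' : (0 : ℚ) < u.length := by exact_mod_cast hpos
  push_cast at this
  linarith

/-- From `5 * x ≤ 2 * p`: for `p ≤ 2` this forces `x = 0`, and for `p ≥ 3` one has `6 * p / 5 ≤ 2 *
p - 2`. -/
theorem stronglyFree_of_plusFree {w : ℕ → Fin 4} {n : ℕ} {F : Set (List (Fin 4))}
    (hF : ∀ i m, i + m ≤ n → factorAt w i m ∈ F) (h : PlusFree (7 / 5) F) :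
    StronglyFree w n := by
  intro i p x hp hi hw
  have := h _ (hF i (p + x) (by omega)) p hp (factorAt_hasPeriod.2 hw)
  rw [length_factorAt, div_le_iff₀ (by exact_mod_cast hp)] at this
  have h2 : (5 * (p + x : ℕ) : ℚ) ≤ (7 * p : ℕ) := by push_cast at this ⊢; linarith
  have h3 : 5 * (p + x) ≤ 7 * p := by exact_mod_cast h2
  omega

theorem window_getD (w : List (Fin 4)) : window (w.getD · 0) 0 w.length = w := by
  have key : ∀ (f : ℕ → Fin 4) (k m : ℕ), window f k m = (List.range m).map fun j => f (k + j) := by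
    intro f k m
    induction m generalizing k with
    | zero => rfl
    | succ m ih =>
      rw [window, ih, List.range_succ_eq_map]
      simp [Function.comp_def, add_comm, add_left_comm]
  rw [key]
  apply List.ext_getElem
  · simp
  · intro t h1 h2
    simp [h2]

theorem infix_iff_factorAt {u L : List (Fin 4)} {f : ℕ → Fin 4}
    (hf : ∀ j < L.length, f j = L.getD j 0) :
    u <:+: L ↔ ∃ i m, u = factorAt f i m ∧ i + m ≤ L.length := by
  constructor
  · rintro ⟨s, t, rfl⟩
    refine ⟨s.length, u.length, ?_, by simp⟩
    apply List.ext_getElem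
    · rw [length_factorAt]
    · intro j h1 h2
      simp only [factorAt, List.getElem_map, List.getElem_range]
      rw [hf _ (by simp; omega), List.append_assoc, List.getD_append_right _ _ _ _ (by omega),
        Nat.add_sub_cancel_left, List.getD_append _ _ _ _ h1, List.getD_eq_getElem _ _ h1]
  · rintro ⟨i, m, rfl, h⟩
    refine infix_of_getD (r := i) (by rwa [length_factorAt]) fun t ht => ?_
    rw [length_factorAt] at ht
    rw [List.getD_eq_getElem?_getD, getElem?_factorAt ht, hf _ (by omega)]
    rfl

theorem mainTheorem7 :
    (∃ w : ℕ → Fin 4,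
      DeanWord (infFactors w) ∧ PlusFree (5 / 3) (infFactors w) ∧
        Avoids (infFactors w) [3, 2, 3]) ∧
    (∀ w : ℕ → Fin 4, PlusFree (7 / 5) (infFactors w) →
      DeanWord (infFactors (deanImageInf w)) ∧ PlusFree (5 / 3) (infFactors (deanImageInf w)) ∧
        Avoids (infFactors (deanImageInf w)) [3, 2, 3]) ∧
    (∀ w : List (Fin 4), PlusFree (7 / 5) (finFactors w) →
      DeanWord (finFactors (deanImage w)) ∧ PlusFree (5 / 3) (finFactors (deanImage w)) ∧
        Avoids (finFactors (deanImage w)) [3, 2, 3]) := by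
  have hinf : ∀ w : ℕ → Fin 4, (∀ n, StronglyFree w n) →
      DeanWord (infFactors (deanImageInf w)) ∧ PlusFree (5 / 3) (infFactors (deanImageInf w)) ∧
        Avoids (infFactors (deanImageInf w)) [3, 2, 3] := by
    intro w hw
    refine dean_of_stronglyFree (w := w) ?_
    rintro u ⟨i, m, rfl⟩
    exact ⟨i, m, i + m, by rw [deanImageInf_eq]; rfl, by omega, hw _⟩
  refine ⟨⟨_, hinf _ stronglyFree_shortBlockFixedPoint⟩, fun w hw => hinf w fun n => ?_,
    fun w hw => ?_⟩
  · exact stronglyFree_of_plusFree (F := infFactors w) (fun i m _ => ⟨i, m, rfl⟩) hw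
  -- A finite word is padded with zeros; only its prefix of length `w.length` is ever used.
  · have hfree : StronglyFree (w.getD · 0) w.length := stronglyFree_of_plusFree
      (F := finFactors w)
      (fun i m h => (infix_iff_factorAt (L := w) fun _ _ => rfl).2 ⟨i, m, rfl, h⟩) hw
    have hlen : (deanImage w).length = 136 * w.length := by
      have := length_flatMap_window deanBlock_length (w.getD · 0) 0 w.length
      rwa [window_getD] at this
    refine dean_of_stronglyFree (w := (w.getD · 0)) fun u hu => ?_
    have hf : ∀ j < (deanImage w).length,
        uniformImage deanBlock 136 (w.getD · 0) j = (deanImage w).getD j 0 := by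
      intro j hj
      have := uniformImage_eq_getD deanBlock_length (w.getD · 0) 0 w.length j (by omega)
      rwa [window_getD, Nat.mul_zero, Nat.zero_add] at this
    obtain ⟨i, m, rfl, him⟩ := (infix_iff_factorAt hf).1 hu
    exact ⟨i, m, w.length, rfl, by omega, hfree⟩
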